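/- Let $\mathbb{F}$ be an infinite field of arbitrary characteristic, let $\mathsf{A}_1=\mathbb{F}\langle x,y\rangle/(yx-xy-1)$ be the Weyl algebra over $\mathbb{F}$, and let $\mathsf{V}\subset\mathsf{A}_1$ be the $\mathbb{F}$-span of $x$ and $y$. Let $\mathbb{F}\langle X\rangle$ be the free unital associative $\mathbb{F}$-algebra on the letters $x_1,x_2,\ldots$. An element $f=f(x_1,\ldots,x_m)$ of $\mathbb{F}\langle X\rangle$ is called a weak polynomial identity for the pair $(\mathsf{A}_1,\mathsf{V})$ if $f(a_1,\ldots,a_m)=0$ in $\mathsf{A}_1$ for all $a_1,\ldots,a_m\in\mathsf{V}$. Writing $[a,b]=ab-ba$, let $\mathcal{I}$ be the two-sided ideal of $\mathbb{F}\langle X\rangle$ generated by the elements $$\Gamma_3(x_i,x_j,x_k)=[[x_i,x_j],x_k],$$ $$\mathrm{St}_3(x_i,x_j,x_k)=x_i[x_j,x_k]-x_j[x_i,x_k]+x_k[x_i,x_j],$$ $$T_4(x_i,x_j,x_k,x_l)=[x_i,x_j][x_k,x_l]-[x_i,x_k][x_j,x_l]+[x_j,x_k][x_i,x_l]$$ for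 all $i,j,k,l\geq 1$. Then every weak polynomial identity $f\in\mathbb{F}\langle X\rangle$ for the pair $(\mathsf{A}_1,\mathsf{V})$ of degree $5$ lies in $\mathcal{I}$. (The degree of $f$ is the maximal length of a word occurring in $f$ with nonzero coefficient; $f$ need not be homogeneous.) -/

import Mathlib

namespace WeylWeakIdentities

open FreeAlgebra

section General

variable (F : Type*) [Field F]

/-- The free unital associative algebra on countably many letters; the letters
`x₁, x₂, …` are indexed by `ℕ`, that is, starting from `0`. -/
abbrev FreeAlg : Type _ := FreeAlgebra F ℕ

variable {F}

/-- The letter with index `i`. -/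
abbrev X (i : ℕ) : FreeAlg F := FreeAlgebra.ι F i

/-- The degree of a noncommutative polynomial: the largest length of a word that occurs in it
with nonzero coefficient (and `0` for the zero polynomial). -/
noncomputable def degree (f : FreeAlg F) : ℕ :=
  (FreeAlgebra.equivMonoidAlgebraFreeMonoid f).coeff.support.sup FreeMonoid.length

/-- `f` is a polynomial identity for the subspace `V` of the algebra `A`: it vanishes under every
substitution of elements of `V` for the letters. -/
def IsIdentityOn {A : Type*} [Ring A] [Algebra F A] (V : Submodule F A) (f : FreeAlg F) : Prop :=
  ∀ a : ℕ → A, (∀ i, a i ∈ V) → FreeAlgebra.lift F a f = 0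

end General

section Weyl

variable (F : Type*) [Field F]

/-- The defining relation `y x = x y + 1`, where `x`, `y` are the letters `0`, `1` of the free
algebra on two letters. -/
inductive WeylRel : FreeAlgebra F (Fin 2) → FreeAlgebra F (Fin 2) → Prop
  | rel : WeylRel (ι F 1 * ι F 0) (ι F 0 * ι F 1 + 1)

/-- The Weyl algebra `A₁ = F⟨x, y⟩ / (y x - x y - 1)`. -/
abbrev WeylAlgebra : Type _ := RingQuot (WeylRel F)

/-- The generator `x` of the Weyl algebra. -/
noncomputable def weylX : WeylAlgebra F := RingQuot.mkAlgHom F (WeylRel F) (ι F 0)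

/-- The generator `y` of the Weyl algebra. -/
noncomputable def weylY : WeylAlgebra F := RingQuot.mkAlgHom F (WeylRel F) (ι F 1)

/-- The subspace `V` of the Weyl algebra spanned by `x` and `y`. -/
noncomputable def weylV : Submodule F (WeylAlgebra F) := Submodule.span F {weylX F, weylY F}

/-- `f` is a weak polynomial identity for the pair `(A₁, V)`. -/
def IsWeakIdentity (f : FreeAlg F) : Prop := IsIdentityOn (weylV F) f

end Weyl

section TheIdeal

variable (F : Type*) [Field F]

/-- `Γ₃(a, b, c) = [[a, b], c]`. -/
def Gamma3 {A : Type*} [Ring A] (a b c : A) : A := ⁅⁅a, b⁆, c⁆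

/-- `St₃(a, b, c) = a [b, c] - b [a, c] + c [a, b]`. -/
def St3 {A : Type*} [Ring A] (a b c : A) : A := a * ⁅b, c⁆ - b * ⁅a, c⁆ + c * ⁅a, b⁆

/-- `T₄(a, b, c, d) = [a, b] [c, d] - [a, c] [b, d] + [b, c] [a, d]`. -/
def T4 {A : Type*} [Ring A] (a b c d : A) : A :=
  ⁅a, b⁆ * ⁅c, d⁆ - ⁅a, c⁆ * ⁅b, d⁆ + ⁅b, c⁆ * ⁅a, d⁆

/-- The two-sided ideal of the free algebra generated by all `Γ₃(xᵢ, xⱼ, xₖ)`,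
`St₃(xᵢ, xⱼ, xₖ)` and `T₄(xᵢ, xⱼ, xₖ, xₗ)`. As these three polynomials are multilinear, it is also
the ideal generated by their values on linear combinations of letters (the L-ideal). -/
def idealI : TwoSidedIdeal (FreeAlg F) :=
  TwoSidedIdeal.span
    ({f | ∃ i j k : ℕ, f = Gamma3 (X i) (X j) (X k)} ∪
      {f | ∃ i j k : ℕ, f = St3 (X i) (X j) (X k)} ∪
      {f | ∃ i j k l : ℕ, f = T4 (X i) (X j) (X k) (X l)})

end TheIdeal

end WeylWeakIdentities

/-!
Adjoin an extra point `0` to the indices of the letters and regard the letter `xⱼ` as the Plücker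
coordinate of the arc `(0, j)` and the commutator `[xᵢ, xⱼ]` as that of the arc `(i, j)`. Modulo the
ideal the coordinates commute up to coordinates of shorter arcs, and `St₃` and `T₄` become the
three-term Plücker relations: they replace two nested arcs by two crossing and two disjoint ones.
Both operations lower the sum of the squared lengths of the arcs, so the straightening algorithm
terminates, and the quotient by the ideal is spanned by the standard tableaux, the products of
increasing chains of arcs.

Conversely, let the letter `xⱼ` act on polynomials as `αⱼ t + βⱼ ∂/∂t` with independent variables
`αⱼ`, `βⱼ`. In this action `[xᵢ, xⱼ]` is multiplication by `βᵢ αⱼ - αᵢ βⱼ`, the relations hold, and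
distinct standard tableaux have distinct leading monomials when applied to `1`. Hence the kernel of
the generic action is precisely the ideal. Over an infinite field, a weak identity is in this kernel
because it vanishes for all scalar values of `αⱼ` and `βⱼ`.
-/

namespace WeylWeakIdentities

section Arcs

theorem exists_perm_pairwise_le {α : Type*} [PartialOrder α] {l : List α}
    (hl : IsChain (· ≤ ·) {x | x ∈ l}) : ∃ l', l.Perm l' ∧ l'.Pairwise (· ≤ ·) := by
  -- On a chain, a linear extension of the order agrees with the order, so we sort along one.
  let L : List (LinearExtension α) := l
  let s : List (LinearExtension α) := L.insertionSort (· ≤ ·)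
  have hs : s.Perm l := L.perm_insertionSort (· ≤ ·)
  refine ⟨s, hs.symm, (L.pairwise_insertionSort (· ≤ ·)).imp_of_mem ?_⟩
  intro (x : α) (y : α) hx hy hxy
  rcases hl.total (hs.subset hx) (hs.subset hy) with h | h
  · exact h
  · exact le_of_eq (α := α) (hxy.antisymm (toLinearExtension.monotone h))

/-- A tableau is standard if it consists of arcs `(i, j)` with `i < j`, any two of which are
comparable, in increasing order. Written as a two-row array with columns `(i, j)`, it has weakly
increasing rows and strictly increasing columns. -/
def IsStandard (T : List (ℕ × ℕ)) : Prop :=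
  (∀ p ∈ T, p.1 < p.2) ∧ T.Pairwise (· ≤ ·)

theorem IsStandard.eq_of_perm {T T' : List (ℕ × ℕ)} (hT : IsStandard T) (hT' : IsStandard T')
    (hfst : (T.map Prod.fst).Perm (T'.map Prod.fst))
    (hsnd : (T.map Prod.snd).Perm (T'.map Prod.snd)) : T = T' := by
  have rows_le {T : List (ℕ × ℕ)} (hT : IsStandard T) :
      (T.map Prod.fst).Pairwise (· ≤ ·) ∧ (T.map Prod.snd).Pairwise (· ≤ ·) :=
    ⟨hT.2.map _ fun _ _ h ↦ h.1, hT.2.map _ fun _ _ h ↦ h.2⟩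
  have fst_eq := hfst.eq_of_pairwise' (rows_le hT).1 (rows_le hT').1
  have snd_eq := hsnd.eq_of_pairwise' (rows_le hT).2 (rows_le hT').2
  rw [← T.zip_unzip, ← T'.zip_unzip, List.unzip_eq_map, List.unzip_eq_map, fst_eq, snd_eq]

/-- The energy of an arc `(i, j)`, the square of its length. As squaring is strictly convex, the
two nested arcs on four points have more energy in total than either of the other pairings. -/
def arcEnergy (p : ℕ × ℕ) : ℕ := (p.2 - p.1) ^ 2

/-- The total energy of the arcs of a tableau, on which straightening is an induction. -/
def energy (T : List (ℕ × ℕ)) : ℕ := (T.map arcEnergy).sum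

theorem energy_append (T U : List (ℕ × ℕ)) : energy (T ++ U) = energy T + energy U := by
  simp [energy]

theorem energy_cons (p : ℕ × ℕ) (T : List (ℕ × ℕ)) :
    energy (p :: T) = arcEnergy p + energy T := by
  simp [energy]

theorem energy_eq_of_perm {T T' : List (ℕ × ℕ)} (h : T.Perm T') : energy T = energy T' :=
  (h.map arcEnergy).sum_eq

theorem arcEnergy_lt_add {i j k : ℕ} (hij : i < j) (hjk : j < k) :
    arcEnergy (j, k) < arcEnergy (i, j) + arcEnergy (i, k) := by
  obtain ⟨d, rfl⟩ := Nat.exists_eq_add_of_lt hij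
  obtain ⟨e, rfl⟩ := Nat.exists_eq_add_of_lt hjk
  simp only [arcEnergy, show i + d + 1 + e + 1 - (i + d + 1) = e + 1 by omega,
    show i + d + 1 - i = d + 1 by omega, show i + d + 1 + e + 1 - i = d + e + 2 by omega]
  nlinarith

theorem arcEnergy_crossing_lt_nested {i k l j : ℕ} (hik : i < k) (hkl : k < l) (hlj : l < j) :
    arcEnergy (i, l) + arcEnergy (k, j) < arcEnergy (i, j) + arcEnergy (k, l) := by
  zify [arcEnergy, hik.le, hkl.le, hlj.le, (hik.trans hkl).le, (hkl.trans hlj).le,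
    (hik.trans (hkl.trans hlj)).le]
  nlinarith

theorem arcEnergy_disjoint_lt_nested {i k l j : ℕ} (hik : i < k) (hkl : k < l) (hlj : l < j) :
    arcEnergy (i, k) + arcEnergy (l, j) < arcEnergy (i, j) + arcEnergy (k, l) := by
  zify [arcEnergy, hik.le, hkl.le, hlj.le, (hik.trans hkl).le, (hkl.trans hlj).le,
    (hik.trans (hkl.trans hlj)).le]
  nlinarith

theorem exists_nested_perm {T : List (ℕ × ℕ)} (hT : ¬ IsChain (· ≤ ·) {p | p ∈ T}) :
    ∃ i j k l T', i < k ∧ l < j ∧ T.Perm ((i, j) :: (k, l) :: T') := by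
  obtain ⟨p, hp, q, hq, h⟩ : ∃ p ∈ T, ∃ q ∈ T, p.1 < q.1 ∧ q.2 < p.2 := by
    contrapose! hT
    intro p hp q hq _
    have hpq := hT p hp q hq
    have hqp := hT q hq p hp
    simp only [Prod.le_def]
    omega
  have hqp : q ∈ T.erase p := (List.mem_erase_of_ne (by rintro rfl; omega)).2 hq
  exact ⟨p.1, p.2, q.1, q.2, _, h.1, h.2,
    (List.perm_cons_erase hp).trans ((List.perm_cons_erase hqp).cons p)⟩

end Arcs

section Straightening

variable {A : Type*} [Ring A]

/-- The relations imposed on the letters `aᵢ` by the generators of the ideal. -/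
structure LetterRelations (a : ℕ → A) : Prop where
  gamma3 : ∀ i j k, Gamma3 (a i) (a j) (a k) = 0
  st3 : ∀ i j k, St3 (a i) (a j) (a k) = 0
  t4 : ∀ i j k l, T4 (a i) (a j) (a k) (a l) = 0

/-- The Plücker coordinates of a family of letters: the arc from `i + 1` to `j + 1` stands for the
commutator `[aᵢ, aⱼ]`, and the arc from the extra point `0` to `j + 1` for the letter `aⱼ`. With
this convention, `St₃` and `T₄` are both three-term Plücker relations. The value at `(i, 0)` is
irrelevant. -/
def bracket (a : ℕ → A) : ℕ × ℕ → A
  | (0, j + 1) => a j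
  | (i + 1, j + 1) => ⁅a i, a j⁆
  | (_, 0) => 0

/-- The product of the Plücker coordinates of the arcs in a list. -/
def tableau (a : ℕ → A) (T : List (ℕ × ℕ)) : A := (T.map (bracket a)).prod

theorem tableau_cons (a : ℕ → A) (p : ℕ × ℕ) (T : List (ℕ × ℕ)) :
    tableau a (p :: T) = bracket a p * tableau a T := by
  simp [tableau]

theorem tableau_append (a : ℕ → A) (T U : List (ℕ × ℕ)) :
    tableau a (T ++ U) = tableau a T * tableau a U := by
  simp [tableau]

theorem map_tableau {B : Type*} [Ring B] (φ : A →+* B) (a : ℕ → A) (T : List (ℕ × ℕ)) :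
    φ (tableau a T) = tableau (φ ∘ a) T := by
  have map_bracket : ∀ p, φ (bracket a p) = bracket (φ ∘ a) p
    | (0, j + 1) => rfl
    | (i + 1, j + 1) => by simp [bracket, Ring.lie_def]
    | (i, 0) => by simp [bracket]
  simp [tableau, map_list_prod, Function.comp_def, map_bracket]

/-- The family of all standard tableaux in the letters `aᵢ`, which turns out to be a basis of the
quotient by the ideal. -/
def standardTableau (a : ℕ → A) (T : {T // IsStandard T}) : A := tableau a T

theorem comp_standardTableau {B : Type*} [Ring B] (φ : A →+* B) (a : ℕ → A) :
    φ ∘ standardTableau a = standardTableau (φ ∘ a) :=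
  funext fun T ↦ map_tableau φ a T

/-- The span of the standard tableaux in the letters `aᵢ`, the target of straightening. -/
def standardSpan (k : Type*) [CommRing k] [Algebra k A] (a : ℕ → A) : Submodule k A :=
  Submodule.span k (Set.range (standardTableau a))

namespace LetterRelations

variable {a : ℕ → A} (ha : LetterRelations a)

include ha

theorem commute_lie (i j k : ℕ) : Commute ⁅a i, a j⁆ (a k) :=
  sub_eq_zero.1 (ha.gamma3 i j k)

theorem commute_lie_lie (i j k l : ℕ) : Commute ⁅a i, a j⁆ ⁅a k, a l⁆ := by
  have hk := ha.commute_lie i j k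
  have hl := ha.commute_lie i j l
  exact (hk.mul_right hl).sub_right (hl.mul_right hk)

theorem bracket_mul_bracket {i k l j : ℕ} (hik : i < k) (hkl : k < l) (hlj : l < j) :
    bracket a (i, j) * bracket a (k, l) =
      bracket a (i, l) * bracket a (k, j) - bracket a (i, k) * bracket a (l, j) := by
  obtain ⟨k, rfl⟩ := Nat.exists_eq_add_one_of_ne_zero (Nat.ne_zero_of_lt hik)
  obtain ⟨l, rfl⟩ := Nat.exists_eq_add_one_of_ne_zero (Nat.ne_zero_of_lt hkl)
  obtain ⟨j, rfl⟩ := Nat.exists_eq_add_one_of_ne_zero (Nat.ne_zero_of_lt hlj)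
  rw [← sub_eq_zero]
  cases i with
  | zero =>
    rw [← ha.st3 k l j, St3]
    simp only [bracket]
    abel
  | succ i =>
    rw [← ha.t4 i k l j, T4]
    simp only [bracket, (ha.commute_lie_lie i j k l).eq]
    abel

theorem lie_bracket_mem (k : Type*) [CommRing k] [Algebra k A] {p q : ℕ × ℕ} (hp : p.1 < p.2)
    (hq : q.1 < q.2) : ⁅bracket a p, bracket a q⁆ ∈ Submodule.span k
      (bracket a '' {r | r.1 < r.2 ∧ arcEnergy r < arcEnergy p + arcEnergy q}) := by
  match p, q, hp, hq with
  | (0, i + 1), (0, j + 1), _, _ =>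
    rcases lt_trichotomy i j with hij | rfl | hij
    · exact Submodule.subset_span ⟨(i + 1, j + 1),
        ⟨by simpa, arcEnergy_lt_add i.succ_pos (by simpa)⟩, rfl⟩
    · simp [Ring.lie_def]
    · rw [← neg_mem_iff, Ring.lie_def, neg_sub, ← Ring.lie_def, add_comm]
      exact Submodule.subset_span ⟨(j + 1, i + 1),
        ⟨by simpa, arcEnergy_lt_add j.succ_pos (by simpa)⟩, rfl⟩
  | (i + 1, j + 1), (0, l + 1), _, _ =>
    simp [bracket, (ha.commute_lie i j l).lie_eq]
  | (0, j + 1), (m + 1, l + 1), _, _ =>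
    simp [bracket, (ha.commute_lie m l j).symm.lie_eq]
  | (i + 1, j + 1), (m + 1, l + 1), _, _ =>
    simp [bracket, (ha.commute_lie_lie i j m l).lie_eq]

theorem tableau_sub_tableau_mem {k : Type*} [CommRing k] [Algebra k A] {S : Submodule k A} {N : ℕ}
    (hS : ∀ T, (∀ p ∈ T, p.1 < p.2) → energy T < N → tableau a T ∈ S) {T T' : List (ℕ × ℕ)}
    (h : T.Perm T') (hT : ∀ p ∈ T, p.1 < p.2) (hN : energy T ≤ N) :
    tableau a T - tableau a T' ∈ S := by
  suffices ∀ U : List (ℕ × ℕ), (∀ p ∈ U ++ T, p.1 < p.2) → energy (U ++ T) ≤ N →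
      tableau a (U ++ T) - tableau a (U ++ T') ∈ S from this [] hT hN
  clear hT hN
  induction h with
  | nil => simp
  | cons p _ ih =>
    intro U hT hN
    simpa using ih (U ++ [p]) (by simpa using hT) (by simpa using hN)
  | trans h _ ih ih' =>
    intro U hT hN
    have hU := h.append_left U
    rw [← sub_add_sub_cancel]
    exact add_mem (ih U hT hN)
      (ih' U (fun p hp ↦ hT p (hU.mem_iff.2 hp)) (energy_eq_of_perm hU ▸ hN))
  | swap p q V =>
    intro U hT hN
    simp only [List.forall_mem_append, List.forall_mem_cons] at hT
    obtain ⟨hU, hq, hp, hV⟩ := hT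
    have span_le : Submodule.span k (bracket a ''
        {r | r.1 < r.2 ∧ arcEnergy r < arcEnergy q + arcEnergy p}) ≤
        S.comap (LinearMap.mulLeftRight k (tableau a U, tableau a V)) := by
      rw [Submodule.span_le]
      rintro _ ⟨r, ⟨hr, hlt⟩, rfl⟩
      have hmem : tableau a (U ++ r :: V) ∈ S := by
        refine hS _ ?_ ?_
        · simpa only [List.forall_mem_append, List.forall_mem_cons] using ⟨hU, hr, hV⟩
        · simp only [energy_append, energy_cons] at hN ⊢
          omega
      simpa [tableau_append, tableau_cons, mul_assoc] using hmem
    have hmem := span_le (ha.lie_bracket_mem k hq hp)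
    simpa [tableau_append, tableau_cons, Ring.lie_def, mul_assoc, mul_sub, sub_mul] using hmem

theorem tableau_mem_standardSpan (k : Type*) [CommRing k] [Algebra k A] {T : List (ℕ × ℕ)}
    (hT : ∀ p ∈ T, p.1 < p.2) : tableau a T ∈ standardSpan k a := by
  induction hN : energy T using Nat.strong_induction_on generalizing T with
  | _ N ih =>
  replace ih : ∀ U, (∀ p ∈ U, p.1 < p.2) → energy U < N → tableau a U ∈ standardSpan k a :=
    fun U hU hlt ↦ ih _ hlt hU rfl
  suffices ∃ U, T.Perm U ∧ tableau a U ∈ standardSpan k a by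
    obtain ⟨U, hTU, hU⟩ := this
    rw [← sub_add_cancel (tableau a T) (tableau a U)]
    exact add_mem (ha.tableau_sub_tableau_mem ih hTU hT hN.le) hU
  by_cases hchain : IsChain (· ≤ ·) {p | p ∈ T}
  · obtain ⟨U, hTU, hU⟩ := exists_perm_pairwise_le hchain
    exact ⟨U, hTU, Submodule.subset_span
      ⟨⟨U, fun p hp ↦ hT p (hTU.mem_iff.2 hp), hU⟩, rfl⟩⟩
  · obtain ⟨i, j, m, l, U, him, hlj, hTU⟩ := exists_nested_perm hchain
    refine ⟨_, hTU, ?_⟩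
    have hU : i < j ∧ m < l ∧ ∀ p ∈ U, p.1 < p.2 := by
      simpa only [List.forall_mem_cons] using fun p hp ↦ hT p (hTU.mem_iff.2 hp)
    obtain ⟨-, hml, hU⟩ := hU
    have hcross := arcEnergy_crossing_lt_nested him hml hlj
    have hdisj := arcEnergy_disjoint_lt_nested him hml hlj
    have htableau : tableau a ((i, j) :: (m, l) :: U) =
        tableau a ((i, l) :: (m, j) :: U) - tableau a ((i, m) :: (l, j) :: U) := by
      simp only [tableau_cons, ← mul_assoc, ← sub_mul, ha.bracket_mul_bracket him hml hlj]
    rw [energy_eq_of_perm hTU] at hN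
    simp only [energy_cons] at hN
    rw [htableau]
    refine sub_mem (ih _ ?_ ?_) (ih _ ?_ ?_)
    · simpa only [List.forall_mem_cons] using ⟨him.trans hml, hml.trans hlj, hU⟩
    · simp only [energy_cons]
      omega
    · simpa only [List.forall_mem_cons] using ⟨him, hlj, hU⟩
    · simp only [energy_cons]
      omega

theorem adjoin_le_standardSpan (k : Type*) [CommRing k] [Algebra k A] :
    Subalgebra.toSubmodule (Algebra.adjoin k (Set.range a)) ≤ standardSpan k a := by
  rw [Algebra.adjoin_eq_span, Submodule.span_le]
  intro x hx
  rw [← FreeMonoid.mrange_lift] at hx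
  obtain ⟨l, rfl⟩ := hx
  have hl : FreeMonoid.lift a l = tableau a (l.toList.map fun j ↦ (0, j + 1)) := by
    simp [FreeMonoid.lift_apply, tableau, Function.comp_def, bracket]
  rw [hl]
  exact ha.tableau_mem_standardSpan k (by simp)

end LetterRelations

end Straightening

section LeadingMonomials

variable {σ k : Type*} [CommRing k]

/-- The polynomials all of whose monomials have weight less than `n`. -/
noncomputable def lowerWeight (k : Type*) [CommRing k] (w : σ → ℕ) (n : ℕ) :
    Submodule k (MvPolynomial σ k) :=
  MvPolynomial.restrictSupport k {m | Finsupp.weight w m < n}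

/-- The polynomial `p` is monic of leading exponent `m` for the weight `w`: the other monomials of
`p` all have smaller weight than that of exponent `m`. -/
def HasLead (w : σ → ℕ) (p : MvPolynomial σ k) (m : σ →₀ ℕ) : Prop :=
  p - MvPolynomial.monomial m 1 ∈ lowerWeight k w (Finsupp.weight w m)

variable {w : σ → ℕ} {p q : MvPolynomial σ k} {m m' : σ →₀ ℕ} {n n' : ℕ}

theorem lowerWeight_mono (h : n ≤ n') : lowerWeight k w n ≤ lowerWeight k w n' :=
  MvPolynomial.restrictSupport_mono k fun _ hm ↦ lt_of_lt_of_le hm h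

theorem coeff_eq_zero_of_mem_lowerWeight (hp : p ∈ lowerWeight k w n)
    (hm : n ≤ Finsupp.weight w m) : p.coeff m = 0 := by
  by_contra h
  exact hm.not_gt (hp (MvPolynomial.mem_support_iff.2 h))

theorem X_mul_mem_lowerWeight {s : σ} (hp : p ∈ lowerWeight k w n) (h : n + w s ≤ n') :
    MvPolynomial.X s * p ∈ lowerWeight k w n' := by
  refine (MvPolynomial.mem_restrictSupport_iff k).2 fun m hm ↦ ?_
  rw [SetLike.mem_coe, MvPolynomial.support_X_mul, Finset.mem_map] at hm
  obtain ⟨m, hm, rfl⟩ := hm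
  have hlt : Finsupp.weight w m < n := hp hm
  have hweight : Finsupp.weight w (addLeftEmbedding (Finsupp.single s 1) m) =
      Finsupp.weight w m + w s := by
    simp [Finsupp.weight_single, add_comm]
  exact hweight.trans_lt (by omega)

theorem pderiv_mem_lowerWeight (s : σ) (hp : p ∈ lowerWeight k w n) :
    MvPolynomial.pderiv s p ∈ lowerWeight k w n := by
  refine (MvPolynomial.mem_restrictSupport_iff k).2 fun m hm ↦ ?_
  rw [SetLike.mem_coe, MvPolynomial.mem_support_iff, MvPolynomial.coeff_pderiv] at hm
  have hlt : Finsupp.weight w (m + Finsupp.single s 1) < n :=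
    hp (MvPolynomial.mem_support_iff.2 (left_ne_zero_of_mul hm))
  rw [map_add] at hlt
  exact (Nat.le_add_right _ _).trans_lt hlt

namespace HasLead

theorem mem_lowerWeight (hp : HasLead w p m) (hn : Finsupp.weight w m < n) :
    p ∈ lowerWeight k w n := by
  rw [← sub_add_cancel p (MvPolynomial.monomial m 1)]
  exact add_mem (lowerWeight_mono hn.le hp)
    ((MvPolynomial.monomial_mem_restrictSupport k).2 (.inl hn))

theorem add_of_mem_lowerWeight (hp : HasLead w p m)
    (hq : q ∈ lowerWeight k w (Finsupp.weight w m)) : HasLead w (p + q) m := by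
  rw [HasLead, add_sub_right_comm]
  exact add_mem hp hq

theorem X_mul (hp : HasLead w p m) (s : σ) :
    HasLead w (MvPolynomial.X s * p) (Finsupp.single s 1 + m) := by
  have hX : MvPolynomial.monomial (Finsupp.single s 1 + m) (1 : k) =
      MvPolynomial.X s * MvPolynomial.monomial m 1 := by
    rw [MvPolynomial.X, MvPolynomial.monomial_mul, one_mul]
  have hw : Finsupp.weight w (Finsupp.single s 1 + m) = Finsupp.weight w m + w s := by
    simp [Finsupp.weight_single, add_comm]
  rw [HasLead, hX, ← mul_sub, hw]
  exact X_mul_mem_lowerWeight hp le_rfl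

theorem coeff_eq [DecidableEq σ] (hp : HasLead w p m)
    (h : Finsupp.weight w m ≤ Finsupp.weight w m') : p.coeff m' = if m = m' then 1 else 0 := by
  have hcoeff := coeff_eq_zero_of_mem_lowerWeight hp h
  rwa [MvPolynomial.coeff_sub, sub_eq_zero, MvPolynomial.coeff_monomial] at hcoeff

end HasLead

theorem linearIndependent_of_hasLead {ι : Type*} {v : ι → MvPolynomial σ k} {m : ι → σ →₀ ℕ}
    (hm : Function.Injective m) (hv : ∀ i, HasLead w (v i) (m i)) : LinearIndependent k v := by
  classical
  refine linearIndependent_iff.2 fun c hc ↦ ?_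
  by_contra hne
  obtain ⟨t, ht, hmax⟩ := c.support.exists_max_image (fun i ↦ Finsupp.weight w (m i))
    (Finsupp.support_nonempty_iff.2 hne)
  have hcoeff : (Finsupp.linearCombination k v c).coeff (m t) = c t := by
    rw [Finsupp.linearCombination_apply, Finsupp.sum, MvPolynomial.coeff_sum,
      Finset.sum_congr rfl fun i hi ↦ by
        rw [MvPolynomial.coeff_smul, (hv i).coeff_eq (hmax i hi)]]
    simp +contextual [hm.eq_iff]
  rw [hc, MvPolynomial.coeff_zero] at hcoeff
  exact Finsupp.mem_support_iff.1 ht hcoeff.symm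

end LeadingMonomials

section LetterOperators

variable {k S : Type*} [CommRing k] [CommRing S] [Algebra k S] (D : Derivation k S S) (t : S)

/-- The operator `u t + v D` on the commutative algebra `S`. If `D t = 1`, then `t` and `D` satisfy
the relation of the Weyl algebra, and this operator represents the element `u x + v y`. -/
def letterOp (u v : S) : Module.End k S :=
  LinearMap.mulLeft k (u * t) + LinearMap.mulLeft k v * D.toLinearMap

theorem letterOp_apply (u v p : S) : letterOp D t u v p = u * (t * p) + v * D p := by
  simp [letterOp]

variable {D t}

theorem lie_letterOp (ht : D t = 1) {u v u' v' : S} (hu : D u = 0) (hv : D v = 0)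
    (hu' : D u' = 0) (hv' : D v' = 0) :
    ⁅letterOp D t u v, letterOp D t u' v'⁆ = LinearMap.mulLeft k (v * u' - u * v') := by
  ext p
  simp only [Ring.lie_def, LinearMap.sub_apply, Module.End.mul_apply, letterOp_apply,
    LinearMap.mulLeft_apply, map_add, Derivation.leibniz, smul_eq_mul, ht, hu, hv, hu', hv']
  ring

theorem letterRelations_letterOp (ht : D t = 1) {u v : ℕ → S} (hu : ∀ i, D (u i) = 0)
    (hv : ∀ i, D (v i) = 0) : LetterRelations fun i ↦ letterOp D t (u i) (v i) := by
  have hlie (i j : ℕ) := lie_letterOp (k := k) ht (hu i) (hv i) (hu j) (hv j)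
  constructor <;> intros <;> ext p <;>
    simp only [Gamma3, St3, T4, hlie, Ring.lie_def, LinearMap.sub_apply, LinearMap.add_apply,
      Module.End.mul_apply, letterOp_apply, LinearMap.mulLeft_apply, LinearMap.zero_apply,
      map_sub, Derivation.leibniz, smul_eq_mul, hu, hv] <;>
    ring

end LetterOperators

section WeylAction

variable {F S : Type*} [Field F] [CommRing S] [Algebra F S] {D : Derivation F S S} {t : S}

/-- The action of the Weyl algebra on a commutative algebra `S` in which `x` acts as multiplication
by `t` and `y` as a derivation `D` with `D t = 1`. -/
noncomputable def weylAction (ht : D t = 1) : WeylAlgebra F →ₐ[F] Module.End F S :=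
  RingQuot.liftAlgHom F ⟨FreeAlgebra.lift F ![LinearMap.mulLeft F t, D.toLinearMap], by
    rintro _ _ ⟨⟩
    ext p
    simp [ht]⟩

theorem weylAction_smul_add_smul (ht : D t = 1) (α β : F) :
    weylAction ht (α • weylX F + β • weylY F) =
      letterOp D t (algebraMap F S α) (algebraMap F S β) := by
  ext p
  simp [weylAction, weylX, weylY, letterOp_apply, Algebra.smul_def]

theorem IsWeakIdentity.lift_letterOp_eq_zero {f : FreeAlg F} (hf : IsWeakIdentity F f)
    (ht : D t = 1) (α β : ℕ → F) :
    FreeAlgebra.lift F (fun j ↦ letterOp D t (algebraMap F S (α j)) (algebraMap F S (β j))) f =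
      0 := by
  have hV (j : ℕ) : α j • weylX F + β j • weylY F ∈ weylV F :=
    add_mem (Submodule.smul_mem _ _ (Submodule.subset_span (by simp)))
      (Submodule.smul_mem _ _ (Submodule.subset_span (by simp)))
  have hcomp : (weylAction ht).comp (FreeAlgebra.lift F fun j ↦ α j • weylX F + β j • weylY F) =
      FreeAlgebra.lift F fun j ↦ letterOp D t (algebraMap F S (α j)) (algebraMap F S (β j)) := by
    ext1
    funext j
    simp [weylAction_smul_add_smul]
  rw [← hcomp, AlgHom.comp_apply, hf _ hV, map_zero]

end WeylAction

section GenericLetters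

variable (k : Type*) [CommRing k]

/-- The action of the generic element `αⱼ x + βⱼ y` on polynomials in `αᵢ`, `βᵢ` and `x`, with `y`
acting as the derivative in `x`. The variable `αⱼ` is encoded as `X (inl (j + 1))`, `βⱼ` as
`X (inr (j + 1))` and `x` as `X (inr 0)`, so that the leading monomial of every Plücker coordinate
`(i, j)` is `X (inr i) * X (inl j)`. -/
noncomputable def genericLetter (j : ℕ) : Module.End k (MvPolynomial (ℕ ⊕ ℕ) k) :=
  letterOp (MvPolynomial.pderiv (.inr 0)) (MvPolynomial.X (.inr 0))
    (MvPolynomial.X (.inl (j + 1))) (MvPolynomial.X (.inr (j + 1)))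

theorem letterRelations_genericLetter : LetterRelations (genericLetter k) :=
  letterRelations_letterOp (MvPolynomial.pderiv_X_self _)
    (fun _ ↦ MvPolynomial.pderiv_X_of_ne (by simp)) fun _ ↦ MvPolynomial.pderiv_X_of_ne (by simp)

theorem lie_genericLetter (i j : ℕ) :
    ⁅genericLetter k i, genericLetter k j⁆ = LinearMap.mulLeft k
      (MvPolynomial.X (.inr (i + 1)) * MvPolynomial.X (.inl (j + 1)) -
        MvPolynomial.X (.inl (i + 1)) * MvPolynomial.X (.inr (j + 1))) := by
  apply lie_letterOp (MvPolynomial.pderiv_X_self _) <;> exact MvPolynomial.pderiv_X_of_ne (by simp)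

/-- The weight in which the variable `inl j` counts `j` times and `inr j` does not count, so that
`X (inr i) * X (inl j)` outweighs `X (inl i) * X (inr j)` for `i < j`. -/
def variableWeight : ℕ ⊕ ℕ → ℕ := Sum.elim id 0

/-- The exponent of the leading monomial of a tableau in the generic letters. -/
noncomputable def leadExponent (T : List (ℕ × ℕ)) : ℕ ⊕ ℕ →₀ ℕ :=
  (T.map fun p ↦ Finsupp.single (.inr p.1) 1 + Finsupp.single (.inl p.2) 1).sum

variable {k}

theorem weight_single_inr_add (i : ℕ) (m : ℕ ⊕ ℕ →₀ ℕ) :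
    Finsupp.weight variableWeight (Finsupp.single (.inr i) 1 + m) =
      Finsupp.weight variableWeight m := by
  simp [variableWeight, Finsupp.weight_single]

theorem weight_single_inl_add (j : ℕ) (m : ℕ ⊕ ℕ →₀ ℕ) :
    Finsupp.weight variableWeight (Finsupp.single (.inl j) 1 + m) =
      j + Finsupp.weight variableWeight m := by
  simp [variableWeight, Finsupp.weight_single]

theorem hasLead_genericLetter {p : MvPolynomial (ℕ ⊕ ℕ) k} {m : ℕ ⊕ ℕ →₀ ℕ}
    (hp : HasLead variableWeight p m) (j : ℕ) :
    HasLead variableWeight (genericLetter k j p)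
      (Finsupp.single (.inr 0) 1 + (Finsupp.single (.inl (j + 1)) 1 + m)) := by
  have happly : genericLetter k j p =
      MvPolynomial.X (.inr 0) * (MvPolynomial.X (.inl (j + 1)) * p) +
        MvPolynomial.X (.inr (j + 1)) * MvPolynomial.pderiv (.inr 0) p := by
    rw [genericLetter, letterOp_apply, mul_left_comm]
  rw [happly]
  refine ((hp.X_mul _).X_mul _).add_of_mem_lowerWeight ?_
  rw [weight_single_inr_add, weight_single_inl_add]
  have hpderiv := pderiv_mem_lowerWeight (.inr 0) (hp.mem_lowerWeight (Nat.lt_succ_self _))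
  refine X_mul_mem_lowerWeight hpderiv ?_
  simp only [variableWeight, Sum.elim_inr, Pi.zero_apply]
  omega

theorem hasLead_lie_genericLetter {p : MvPolynomial (ℕ ⊕ ℕ) k} {m : ℕ ⊕ ℕ →₀ ℕ}
    (hp : HasLead variableWeight p m) {i j : ℕ} (hij : i < j) :
    HasLead variableWeight (⁅genericLetter k i, genericLetter k j⁆ p)
      (Finsupp.single (.inr (i + 1)) 1 + (Finsupp.single (.inl (j + 1)) 1 + m)) := by
  rw [lie_genericLetter, LinearMap.mulLeft_apply, sub_mul, mul_assoc, mul_assoc,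
    mul_left_comm (MvPolynomial.X (.inl (i + 1)) : MvPolynomial (ℕ ⊕ ℕ) k), sub_eq_add_neg]
  refine ((hp.X_mul _).X_mul _).add_of_mem_lowerWeight (neg_mem ?_)
  rw [weight_single_inr_add, weight_single_inl_add]
  refine X_mul_mem_lowerWeight ((hp.X_mul _).mem_lowerWeight (Nat.lt_succ_self _)) ?_
  rw [weight_single_inl_add]
  simp only [variableWeight, Sum.elim_inr, Pi.zero_apply]
  omega

theorem hasLead_bracket_genericLetter {p : MvPolynomial (ℕ ⊕ ℕ) k} {m : ℕ ⊕ ℕ →₀ ℕ}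
    (hp : HasLead variableWeight p m) : ∀ {q : ℕ × ℕ}, q.1 < q.2 →
      HasLead variableWeight (bracket (genericLetter k) q p)
        (Finsupp.single (.inr q.1) 1 + (Finsupp.single (.inl q.2) 1 + m))
  | (0, j + 1), _ => hasLead_genericLetter hp j
  | (_ + 1, _ + 1), hq => hasLead_lie_genericLetter hp (Nat.succ_lt_succ_iff.1 hq)

theorem leadExponent_cons (p : ℕ × ℕ) (T : List (ℕ × ℕ)) :
    leadExponent (p :: T) =
      Finsupp.single (.inr p.1) 1 + (Finsupp.single (.inl p.2) 1 + leadExponent T) := by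
  rw [leadExponent, List.map_cons, List.sum_cons, add_assoc, leadExponent]

theorem hasLead_tableau_genericLetter {T : List (ℕ × ℕ)} (hT : ∀ p ∈ T, p.1 < p.2) :
    HasLead variableWeight (tableau (genericLetter k) T 1) (leadExponent T) := by
  induction T with
  | nil => simp [HasLead, tableau, leadExponent]
  | cons p T ih =>
    rw [List.forall_mem_cons] at hT
    rw [tableau_cons, Module.End.mul_apply, leadExponent_cons]
    exact hasLead_bracket_genericLetter (ih hT.2) hT.1

theorem leadExponent_inr (T : List (ℕ × ℕ)) (i : ℕ) :
    leadExponent T (.inr i) = (T.map Prod.fst).count i := by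
  induction T with
  | nil => simp [leadExponent]
  | cons p T ih =>
    simp [leadExponent_cons, ih, List.count_cons, Finsupp.single_apply, add_comm]

theorem leadExponent_inl (T : List (ℕ × ℕ)) (j : ℕ) :
    leadExponent T (.inl j) = (T.map Prod.snd).count j := by
  induction T with
  | nil => simp [leadExponent]
  | cons p T ih =>
    simp [leadExponent_cons, ih, List.count_cons, Finsupp.single_apply, add_comm]

theorem injOn_leadExponent : Set.InjOn leadExponent {T | IsStandard T} := by
  intro T hT T' hT' h
  refine hT.eq_of_perm hT' (List.perm_iff_count.2 fun i ↦ ?_) (List.perm_iff_count.2 fun j ↦ ?_)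
  · rw [← leadExponent_inr, ← leadExponent_inr, h]
  · rw [← leadExponent_inl, ← leadExponent_inl, h]

variable (k) in
theorem linearIndependent_standardTableau_genericLetter :
    LinearIndependent k fun T ↦ standardTableau (genericLetter k) T 1 :=
  linearIndependent_of_hasLead injOn_leadExponent.injective
    fun T ↦ hasLead_tableau_genericLetter T.2.1

end GenericLetters

theorem map_lift_apply {k M N ι : Type*} [CommSemiring k] [AddCommMonoid M] [Module k M]
    [AddCommMonoid N] [Module k N] {φ : M →ₗ[k] N} {T : ι → Module.End k M}
    {U : ι → Module.End k N} (hφ : ∀ i x, φ (T i x) = U i (φ x)) (f : FreeAlgebra k ι) (x : M) :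
    φ (FreeAlgebra.lift k T f x) = FreeAlgebra.lift k U f (φ x) := by
  induction f using FreeAlgebra.induction generalizing x with
  | grade0 r => simp [Module.algebraMap_end_apply]
  | grade1 i => simpa using hφ i x
  | mul f g hf hg => simp [hf, hg]
  | add f g hf hg => simp [hf, hg]

section Specialization

variable {k : Type*} [CommRing k]

/-- The specialization of the coefficients of the generic letters to scalars, which keeps the
variable `x = X (inr 0)`. -/
noncomputable def specialize (α β : ℕ → k) :
    MvPolynomial (ℕ ⊕ ℕ) k →ₐ[k] MvPolynomial (ℕ ⊕ ℕ) k :=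
  MvPolynomial.aeval (Sum.elim (fun j ↦ .C (α j))
    fun j ↦ if j = 0 then MvPolynomial.X (.inr 0) else .C (β j))

theorem pderiv_specialize (α β : ℕ → k) (p : MvPolynomial (ℕ ⊕ ℕ) k) :
    specialize α β (MvPolynomial.pderiv (.inr 0) p) =
      MvPolynomial.pderiv (.inr 0) (specialize α β p) := by
  have pderiv_X : ∀ s, specialize α β (MvPolynomial.pderiv (.inr 0) (.X s)) =
      MvPolynomial.pderiv (.inr 0) (specialize α β (.X s))
    | .inl j => by simp [specialize]
    | .inr 0 => by simp [specialize]
    | .inr (j + 1) => by simp [specialize]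
  induction p using MvPolynomial.induction_on with
  | C r => simp [specialize]
  | add p q hp hq => simp [hp, hq]
  | mul_X p s hp => simp only [Derivation.leibniz, map_mul, map_add, smul_eq_mul, hp, pderiv_X]

theorem specialize_genericLetter (α β : ℕ → k) (j : ℕ) (p : MvPolynomial (ℕ ⊕ ℕ) k) :
    specialize α β (genericLetter k j p) =
      letterOp (MvPolynomial.pderiv (.inr 0)) (MvPolynomial.X (.inr 0)) (.C (α (j + 1)))
        (.C (β (j + 1))) (specialize α β p) := by
  simp only [genericLetter, letterOp_apply, map_add, map_mul, pderiv_specialize]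
  simp [specialize]

theorem eq_zero_of_specialize_eq_zero [IsDomain k] [Infinite k] {p : MvPolynomial (ℕ ⊕ ℕ) k}
    (hp : ∀ α β : ℕ → k, specialize α β p = 0) : p = 0 := by
  refine MvPolynomial.funext fun v ↦ ?_
  have eval_specialize : (MvPolynomial.aeval v).comp (specialize (v ∘ .inl) (v ∘ .inr)) =
      MvPolynomial.aeval v := by
    ext (j | _ | j) <;> simp [specialize]
  rw [← MvPolynomial.coe_aeval_eq_eval, RingHom.coe_coe, ← eval_specialize, AlgHom.comp_apply, hp]
  simp

end Specialization

theorem IsWeakIdentity.lift_genericLetter_eq_zero {F : Type*} [Field F] [Infinite F]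
    {f : FreeAlg F} (hf : IsWeakIdentity F f) : FreeAlgebra.lift F (genericLetter F) f = 0 := by
  refine LinearMap.ext fun p ↦ eq_zero_of_specialize_eq_zero fun α β ↦ ?_
  have hφ := map_lift_apply (φ := (specialize α β).toLinearMap) (specialize_genericLetter α β) f p
  have hzero := hf.lift_letterOp_eq_zero (MvPolynomial.pderiv_X_self (R := F) (.inr 0 : ℕ ⊕ ℕ))
    (fun j ↦ α (j + 1)) fun j ↦ β (j + 1)
  rw [MvPolynomial.algebraMap_eq] at hzero
  exact hφ.trans (by rw [hzero, LinearMap.zero_apply])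

section IdealI

variable {F : Type*} [Field F]

theorem idealI_le_ker_iff {A : Type*} [Ring A] [Algebra F A] {φ : FreeAlg F →ₐ[F] A} :
    idealI F ≤ TwoSidedIdeal.ker φ ↔ LetterRelations fun i ↦ φ (X i) := by
  have map_gamma3 (i j k : ℕ) :
      φ (Gamma3 (X i) (X j) (X k)) = Gamma3 (φ (X i)) (φ (X j)) (φ (X k)) := by
    simp [Gamma3, Ring.lie_def]
  have map_st3 (i j k : ℕ) : φ (St3 (X i) (X j) (X k)) = St3 (φ (X i)) (φ (X j)) (φ (X k)) := by
    simp [St3, Ring.lie_def]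
  have map_t4 (i j k l : ℕ) :
      φ (T4 (X i) (X j) (X k) (X l)) = T4 (φ (X i)) (φ (X j)) (φ (X k)) (φ (X l)) := by
    simp [T4, Ring.lie_def]
  rw [idealI, TwoSidedIdeal.span_le]
  constructor
  · intro h
    have map_eq_zero {g : FreeAlg F} (hg : g ∈ _) : φ g = 0 := (TwoSidedIdeal.mem_ker φ).1 (h hg)
    exact
      { gamma3 := fun i j k ↦ map_gamma3 i j k ▸ map_eq_zero (.inl (.inl ⟨i, j, k, rfl⟩))
        st3 := fun i j k ↦ map_st3 i j k ▸ map_eq_zero (.inl (.inr ⟨i, j, k, rfl⟩))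
        t4 := fun i j k l ↦ map_t4 i j k l ▸ map_eq_zero (.inr ⟨i, j, k, l, rfl⟩) }
  · rintro h _ ((⟨i, j, k, rfl⟩ | ⟨i, j, k, rfl⟩) | ⟨i, j, k, l, rfl⟩) <;>
      rw [SetLike.mem_coe, TwoSidedIdeal.mem_ker]
    · rw [map_gamma3, h.gamma3]
    · rw [map_st3, h.st3]
    · rw [map_t4, h.t4]

variable (F)

theorem ker_mk_idealI : TwoSidedIdeal.ker ((idealI F).ringCon.mkₐ F) = idealI F :=
  TwoSidedIdeal.ker_ringCon_mk' _

theorem standardSpan_mk_eq_top :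
    standardSpan F (fun i ↦ (idealI F).ringCon.mkₐ F (X i)) = ⊤ := by
  have relations := idealI_le_ker_iff.1 (ker_mk_idealI F).ge
  have generate : Algebra.adjoin F (Set.range fun i ↦ (idealI F).ringCon.mkₐ F (X i)) = ⊤ := by
    rw [Set.range_comp', ← AlgHom.map_adjoin, FreeAlgebra.adjoin_range_ι, Algebra.map_top,
      AlgHom.range_eq_top]
    exact RingCon.mkₐ_surjective _
  rw [eq_top_iff, ← Algebra.top_toSubmodule, ← generate]
  exact relations.adjoin_le_standardSpan F

end IdealI

theorem ker_le_ker_of_span_eq_top_of_linearIndependent {k M N P ι : Type*} [Ring k]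
    [AddCommGroup M] [Module k M] [AddCommGroup N] [Module k N] [AddCommGroup P] [Module k P]
    {φ : M →ₗ[k] N} {ψ : M →ₗ[k] P} (hφψ : LinearMap.ker φ ≤ LinearMap.ker ψ) {v : ι → M}
    (hspan : Submodule.span k (Set.range (φ ∘ v)) = ⊤) (hindep : LinearIndependent k (ψ ∘ v)) :
    LinearMap.ker ψ ≤ LinearMap.ker φ := by
  intro x hx
  obtain ⟨c, hc⟩ : ∃ c, Finsupp.linearCombination k (φ ∘ v) c = φ x := by
    rw [← LinearMap.mem_range, Finsupp.range_linearCombination, hspan]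
    exact Submodule.mem_top
  rw [← Finsupp.apply_linearCombination] at hc
  have hψ : Finsupp.linearCombination k (ψ ∘ v) c = 0 := by
    rw [← Finsupp.apply_linearCombination, ← LinearMap.mem_ker.1 hx, ← LinearMap.sub_mem_ker_iff]
    exact hφψ (LinearMap.sub_mem_ker_iff.2 hc)
  rw [LinearMap.mem_ker, ← hc, linearIndependent_iff.1 hindep c hψ, map_zero, map_zero]

theorem ker_lift_genericLetter (F : Type*) [Field F] :
    TwoSidedIdeal.ker (FreeAlgebra.lift F (genericLetter F)) = idealI F := by
  let quot := (idealI F).ringCon.mkₐ F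
  let generic := FreeAlgebra.lift F (genericLetter F)
  let ψ : FreeAlg F →ₗ[F] MvPolynomial (ℕ ⊕ ℕ) F := LinearMap.applyₗ 1 ∘ₗ generic.toLinearMap
  have idealI_le_ker : idealI F ≤ TwoSidedIdeal.ker generic :=
    idealI_le_ker_iff.2 (by simpa [generic] using letterRelations_genericLetter F)
  refine le_antisymm (fun f hf ↦ ?_) idealI_le_ker
  have mem_idealI_iff (g : FreeAlg F) : g ∈ idealI F ↔ quot g = 0 := by
    rw [← TwoSidedIdeal.mem_ker, ker_mk_idealI]
  have hker : LinearMap.ker quot.toLinearMap ≤ LinearMap.ker ψ := fun g hg ↦ by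
    have hgeneric : generic g = 0 :=
      (TwoSidedIdeal.mem_ker _).1 (idealI_le_ker ((mem_idealI_iff g).2 hg))
    simp [ψ, hgeneric]
  have hspan : Submodule.span F (Set.range (quot ∘ standardTableau X)) = ⊤ := by
    rw [← RingHom.coe_coe, comp_standardTableau]
    exact standardSpan_mk_eq_top F
  have hindep : LinearIndependent F (ψ ∘ standardTableau X) := by
    have hindep := linearIndependent_standardTableau_genericLetter F
    have hgeneric : generic ∘ standardTableau X = standardTableau (genericLetter F) := by
      rw [← RingHom.coe_coe, comp_standardTableau, RingHom.coe_coe, FreeAlgebra.ι_comp_lift]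
    rw [← hgeneric] at hindep
    exact hindep
  have hψ : f ∈ LinearMap.ker ψ := by
    simp [ψ, generic, (TwoSidedIdeal.mem_ker _).1 hf]
  exact (mem_idealI_iff f).2
    (ker_le_ker_of_span_eq_top_of_linearIndependent hker hspan hindep hψ)

end WeylWeakIdentities

theorem mainTheorem4_general (F : Type*) [Field F] [Infinite F] (f : WeylWeakIdentities.FreeAlg F)
    (hf : WeylWeakIdentities.IsWeakIdentity F f) : f ∈ WeylWeakIdentities.idealI F := by
  rw [← WeylWeakIdentities.ker_lift_genericLetter, TwoSidedIdeal.mem_ker]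
  exact hf.lift_genericLetter_eq_zero

theorem mainTheorem4 (F : Type*) [Field F] [Infinite F] (f : WeylWeakIdentities.FreeAlg F)
    (hf : WeylWeakIdentities.IsWeakIdentity F f) (hdeg : WeylWeakIdentities.degree f = 5) :
    f ∈ WeylWeakIdentities.idealI F :=
  mainTheorem4_general F f hf
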